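/- Write $\mathcal P_n=\{I,X,Y,Z\}^{\otimes n}$ for the $n$-qubit Pauli strings, and expand an operator $A$ on $n$ qubits as $A=\sum_{P\in\mathcal P_n}\alpha_P P$ with $\alpha_P=2^{-n}\operatorname{tr}(PA)$. Let $\|A\|_\infty$ be the operator norm, $\|A\|_F=(2^{-n}\operatorname{tr}A^*A)^{1/2}$ the normalized Frobenius norm, $\|A\|_{\ell_\infty}=\max_P|\alpha_P|$ and $\operatorname{supp}_P(A)=|\{P:\alpha_P\neq 0\}|$. For Hermitian $A$ and $\delta\ge 0$ let $\operatorname{supp}_P(A,\delta)=\min\{\operatorname{supp}_P(B): B \text{ Hermitian},\ \|A-B\|_F\le\delta\}$. There are absolute constants $0<c_1\le c_2$, and constants $A_{K,\ell}$ depending only on $K$ and $\ell$, such that for all integers $K,m\ge 1$ and every real $C\ge 1$ there is a time $T$ with $$c_1\,\frac{m^{-1/K}}{C}\ \le\ T\ \le\ c_2\,\frac{m^{-1/K}}{C}$$ (that is, $T=\Theta(m^{-1/K}/C)$) for which the following holds for every $n$, every $\varepsilon>0$, and all traceless Hermitian $n$-qubit operators $H,H_j$ with $\operatorname{supp}_P(H),\operatorname{supp}_P(H_j)\le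 m$, $\|H\|_\infty,\|H_j\|_\infty\le C$ and $\|H-H_j\|_{\ell_\infty}\le\varepsilon$. There is exactly one Hermitian $W_j$ with $\|W_j\|_\infty<\pi$ and $e^{-iW_j}=e^{iH_jT}e^{-iHT}$ (so $-iW_j$ is the principal logarithm of $e^{iH_jT}e^{-iHT}$), and it satisfies $$\|W_j\|_F\le\sqrt m\,\varepsilon,\qquad \|W_j\|_\infty\le m\,\varepsilon,$$ $$\operatorname{supp}_P\!\left(W_j,\ \frac{m^{-\ell/K}\varepsilon}{8}\right)\le A_{K,\ell}\; m^{\lceil \ell+K/2\rceil-1}\qquad\text{for every real }\ell\ge 1 .$$ In particular the last bound is $O(m^{\ell+K/2-1})$ whenever $\ell+K/2$ is an integer. -/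

import Mathlib

namespace PauliBCH

/-- Operators on `n` qubits: complex `2^n × 2^n` matrices, with rows and columns indexed by the
computational basis states `Fin n → Fin 2`. -/
abbrev QMatrix (n : ℕ) : Type := Matrix (Fin n → Fin 2) (Fin n → Fin 2) ℂ

/-- The four single-qubit Pauli matrices `I, X, Y, Z`. -/
def pauli : Fin 4 → Matrix (Fin 2) (Fin 2) ℂ :=
  ![!![1, 0; 0, 1], !![0, 1; 1, 0], !![0, -Complex.I; Complex.I, 0], !![1, 0; 0, -1]]

/-- The `n`-qubit Pauli string `σ_{x 0} ⊗ ⋯ ⊗ σ_{x (n-1)}` (iterated Kronecker product). -/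
def pauliString {n : ℕ} (x : Fin n → Fin 4) : QMatrix n :=
  Matrix.of fun a b => ∏ i, pauli (x i) (a i) (b i)

/-- The coefficient `α_x = tr(P_x A) / 2^n` in the Pauli expansion `A = ∑ x, α_x P_x`. -/
noncomputable def pauliCoeff {n : ℕ} (A : QMatrix n) (x : Fin n → Fin 4) : ℂ :=
  (pauliString x * A).trace / 2 ^ n

/-- Pauli sparsity: the number of nonzero Pauli coefficients. -/
noncomputable def pauliSparsity {n : ℕ} (A : QMatrix n) : ℕ :=
  Set.ncard {x | pauliCoeff A x ≠ 0}

/-- The largest absolute value of a Pauli coefficient. -/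
noncomputable def pauliLinftyNorm {n : ℕ} (A : QMatrix n) : ℝ :=
  ⨆ x, ‖pauliCoeff A x‖

/-- The operator norm with respect to the Euclidean norm on `ℂ^(2^n)`. -/
noncomputable def opNorm {n : ℕ} (A : QMatrix n) : ℝ :=
  ‖Matrix.toEuclideanCLM (𝕜 := ℂ) A‖

/-- The normalized Frobenius norm `sqrt(tr(A* A) / 2^n)`. -/
noncomputable def frobNorm {n : ℕ} (A : QMatrix n) : ℝ :=
  Real.sqrt ((∑ a, ∑ b, ‖A a b‖ ^ 2) / 2 ^ n)

/-- Pauli quasi-sparsity: the least Pauli sparsity of a Hamiltonian (Hermitian operator) within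
normalized Frobenius distance `δ` of `A`. -/
noncomputable def pauliQuasiSparsity {n : ℕ} (A : QMatrix n) (δ : ℝ) : ℕ :=
  sInf {s | ∃ B : QMatrix n, B.IsHermitian ∧ frobNorm (A - B) ≤ δ ∧ pauliSparsity B = s}

/-- For a Hermitian operator and `0 ≤ δ`, the minimum defining the quasi-sparsity is attained. -/
theorem pauliQuasiSparsity_attained {n : ℕ} (A : QMatrix n) (hA : A.IsHermitian) {δ : ℝ}
    (hδ : 0 ≤ δ) : ∃ B : QMatrix n, B.IsHermitian ∧ frobNorm (A - B) ≤ δ ∧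
      pauliSparsity B = pauliQuasiSparsity A δ :=
  Nat.sInf_mem (s := {s | ∃ B : QMatrix n, B.IsHermitian ∧ frobNorm (A - B) ≤ δ ∧
    pauliSparsity B = s}) ⟨pauliSparsity A, A, hA, by simpa [frobNorm] using hδ, rfl⟩

/-- `W` is the (principal) Hermitian generator of `e^{i H' T} e^{-i H T}`: it is Hermitian with
`e^{-i W} = e^{i H' T} e^{-i H T}`, and its eigenvalues lie in `(-π, π)`, that is,
`-i W = log (e^{i H' T} e^{-i H T})` for the principal branch of the logarithm. -/
def IsGenerator {n : ℕ} (H H' : QMatrix n) (T : ℝ) (W : QMatrix n) : Prop :=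
  W.IsHermitian ∧ opNorm W < Real.pi ∧
    NormedSpace.exp (-(Complex.I • W)) =
      NormedSpace.exp ((Complex.I * (T : ℂ)) • H') *
        NormedSpace.exp (-((Complex.I * (T : ℂ)) • H))

end PauliBCH

/-! Put `x = iTH'`, `y = iTH`, and let `V` be the span of the identity and the Pauli strings
occurring in `H` or `H'`, at most `2m + 1` strings. A product of Pauli strings is a scalar times a
Pauli string, so every element of `V ^ N` has Pauli sparsity at most `(2m + 1) ^ N`. It remains to
approximate the logarithm of `exp x * exp (-y)` by an element of `V ^ N` in Frobenius norm.

With `E = exp x * exp (-y) - 1`, the series of `log (1 + E)` is cut after `N` powers, and each power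
of `E` is cut at degree `N` in `V`. Every term contains a factor `x - y`, so the error is
proportional to its Frobenius norm, at most `T * (3/2) * √m * ε`. With `μ = m ^ (-1/K)` and `T = μ /
(32 C)`, both `x` and `y` have operator norm at most `μ / 32`; degree truncation then gains `μ ^ N`,
and `T` supplies one more `μ`. The choice `N = ⌈ℓ + K/2⌉ - 1` makes `μ ^ (N + 1) * √m ≤ m ^ (-ℓ/K)`.

The normalized Frobenius norm is not submultiplicative, but it is an ideal seminorm for the operator
norm; the estimates therefore carry both norms (`HasWeightedExpansion`). They are combined in
`exists_approx_log`. -/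

namespace PauliBCH

open NormedSpace

/-! ### Power expansions graded by degree, with weighted bounds in an ideal seminorm -/

section Expansion

variable {𝔸 : Type*} [NormedRing 𝔸] [NormedAlgebra ℂ 𝔸]

/-- A seminorm on a normed algebra is ideal if multiplication is bounded by the product of the
seminorm of one factor and the norm of the other. -/
structure IsIdealSeminorm (ν : Seminorm ℂ 𝔸) : Prop where
  mul_le_mul_norm : ∀ x y, ν (x * y) ≤ ν x * ‖y‖
  mul_le_norm_mul : ∀ x y, ν (x * y) ≤ ‖x‖ * ν y

theorem isIdealSeminorm_normSeminorm : IsIdealSeminorm (normSeminorm ℂ 𝔸) :=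
  ⟨norm_mul_le, norm_mul_le⟩

theorem IsIdealSeminorm.le_norm {ν : Seminorm ℂ 𝔸} (hν : IsIdealSeminorm ν) (x : 𝔸) :
    ν x ≤ ν 1 * ‖x‖ := by
  simpa using hν.mul_le_mul_norm 1 x

theorem IsIdealSeminorm.continuous {ν : Seminorm ℂ 𝔸} (hν : IsIdealSeminorm ν) :
    Continuous ν := by
  refine Seminorm.continuous_of_le (q := (ν 1).toNNReal • normSeminorm ℂ 𝔸) ?_ ?_
  · exact continuous_const.mul continuous_norm
  · intro x
    simpa [NNReal.smul_def, apply_nonneg] using hν.le_norm x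

theorem IsIdealSeminorm.le_of_hasSum {ν : Seminorm ℂ 𝔸} (hν : IsIdealSeminorm ν)
    {c : ℕ → 𝔸} {x : 𝔸} (hc : HasSum c x) {v : ℕ → ℝ} {f : ℝ} (hcv : ∀ k, ν (c k) ≤ v k)
    (hv : HasSum v f) : ν x ≤ f := by
  refine le_of_tendsto ((hν.continuous.tendsto x).comp hc) (Filter.Eventually.of_forall fun s => ?_)
  calc ν (∑ k ∈ s, c k) ≤ ∑ k ∈ s, ν (c k) :=
        Finset.le_sum_of_subadditive ν (map_zero ν).le (map_add_le_add ν) s c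
    _ ≤ ∑ k ∈ s, v k := Finset.sum_le_sum fun k _ => hcv k
    _ ≤ f := sum_le_hasSum s (fun k _ => (apply_nonneg ν _).trans (hcv k)) hv

theorem IsIdealSeminorm.pow_succ_le [NormOneClass 𝔸] {ν : Seminorm ℂ 𝔸} (hν : IsIdealSeminorm ν)
    (x : 𝔸) (k : ℕ) : ν (x ^ (k + 1)) ≤ ν x * ‖x‖ ^ k := by
  rw [pow_succ']
  exact (hν.mul_le_mul_norm _ _).trans
    (mul_le_mul_of_nonneg_left (norm_pow_le x k) (apply_nonneg ν x))

/-- Telescoping isolates one factor `x - y`, measured by `ν`; the other `k` factors are measured by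
the norm. -/
theorem IsIdealSeminorm.pow_sub_pow_le [NormOneClass 𝔸] {ν : Seminorm ℂ 𝔸}
    (hν : IsIdealSeminorm ν) {x y : 𝔸} {q : ℝ} (hx : ‖x‖ ≤ q) (hy : ‖y‖ ≤ q) (k : ℕ) :
    ν (x ^ (k + 1) - y ^ (k + 1)) ≤ (k + 1) * q ^ k * ν (x - y) := by
  have hq : 0 ≤ q := (norm_nonneg x).trans hx
  induction k with
  | zero => simp
  | succ k ih =>
    have e : x ^ (k + 1 + 1) - y ^ (k + 1 + 1)
        = x * (x ^ (k + 1) - y ^ (k + 1)) + (x - y) * y ^ (k + 1) := by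
      rw [pow_succ' x (k + 1), pow_succ' y (k + 1)]; noncomm_ring
    rw [e]
    have h1 : ν (x * (x ^ (k + 1) - y ^ (k + 1))) ≤ q * ((k + 1) * q ^ k * ν (x - y)) :=
      (hν.mul_le_norm_mul _ _).trans (mul_le_mul hx ih (apply_nonneg ν _) hq)
    have h2 : ν ((x - y) * y ^ (k + 1)) ≤ ν (x - y) * q ^ (k + 1) :=
      (hν.mul_le_mul_norm _ _).trans (mul_le_mul_of_nonneg_left
        ((norm_pow_le y _).trans (pow_le_pow_left₀ (norm_nonneg y) hy _)) (apply_nonneg ν _))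
    refine (map_add_le_add ν _ _).trans ((add_le_add h1 h2).trans (le_of_eq ?_))
    push_cast; ring

/-- `x` is a sum of terms of degree `k` in `V` whose norms and seminorms, weighted by `R ^ k`, have
majorants with sums `a` and `f`. -/
def HasWeightedExpansion (V : Submodule ℂ 𝔸) (ν : Seminorm ℂ 𝔸) (R a f : ℝ) (x : 𝔸) : Prop :=
  ∃ (c : ℕ → 𝔸) (u v : ℕ → ℝ), (∀ k, c k ∈ V ^ k) ∧ HasSum c x ∧
    (∀ k, ‖c k‖ * R ^ k ≤ u k) ∧ HasSum u a ∧ (∀ k, ν (c k) * R ^ k ≤ v k) ∧ HasSum v f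

theorem hasSum_antidiagonal {u v : ℕ → ℝ} {a b : ℝ} (hu : HasSum u a) (hv : HasSum v b)
    (hu0 : ∀ k, 0 ≤ u k) (hv0 : ∀ k, 0 ≤ v k) :
    HasSum (fun k => ∑ p ∈ Finset.HasAntidiagonal.antidiagonal k, u p.1 * v p.2) (a * b) := by
  have hu' : Summable fun k => ‖u k‖ := by simpa [abs_of_nonneg, hu0] using hu.summable
  have hv' : Summable fun k => ‖v k‖ := by simpa [abs_of_nonneg, hv0] using hv.summable
  rw [← hu.tsum_eq, ← hv.tsum_eq, tsum_mul_tsum_eq_tsum_sum_antidiagonal_of_summable_norm hu' hv']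
  exact (summable_norm_sum_mul_antidiagonal_of_summable_norm hu' hv').of_norm.hasSum

theorem norm_le_of_mul_pow_le {c u R : ℝ} (hc : 0 ≤ c) (hR : 1 ≤ R) {k : ℕ} (h : c * R ^ k ≤ u) :
    c ≤ u :=
  (le_mul_of_one_le_right hc (one_le_pow₀ hR)).trans h

/-- Cauchy product. Only the left factor is measured in `ν`, hence the asymmetric bound `f * a'`. -/
theorem HasWeightedExpansion.mul [CompleteSpace 𝔸] {V : Submodule ℂ 𝔸} {ν : Seminorm ℂ 𝔸}
    (hν : IsIdealSeminorm ν) {R a f a' f' : ℝ} {x y : 𝔸} (hR : 1 ≤ R)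
    (hx : HasWeightedExpansion V ν R a f x) (hy : HasWeightedExpansion V ν R a' f' y) :
    HasWeightedExpansion V ν R (a * a') (f * a') (x * y) := by
  obtain ⟨c, u, v, hc, hcs, hcu, hu, hcv, hv⟩ := hx
  obtain ⟨c', u', v', hc', hcs', hcu', hu', -, -⟩ := hy
  have hR0 : 0 ≤ R := by linarith
  have u0 : ∀ k, 0 ≤ u k := fun k => (by positivity : 0 ≤ ‖c k‖ * R ^ k).trans (hcu k)
  have u0' : ∀ k, 0 ≤ u' k := fun k => (by positivity : 0 ≤ ‖c' k‖ * R ^ k).trans (hcu' k)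
  have v0 : ∀ k, 0 ≤ v k := fun k =>
    (mul_nonneg (apply_nonneg ν _) (by positivity) : 0 ≤ ν (c k) * R ^ k).trans (hcv k)
  have n1 : Summable fun k => ‖c k‖ := hu.summable.of_nonneg_of_le (fun _ => norm_nonneg _)
    fun k => norm_le_of_mul_pow_le (norm_nonneg _) hR (hcu k)
  have n2 : Summable fun k => ‖c' k‖ := hu'.summable.of_nonneg_of_le (fun _ => norm_nonneg _)
    fun k => norm_le_of_mul_pow_le (norm_nonneg _) hR (hcu' k)
  have key : ∀ (μ : Seminorm ℂ 𝔸) (w : ℕ → ℝ), (∀ x y, μ (x * y) ≤ μ x * ‖y‖) →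
      (∀ k, 0 ≤ w k) → (∀ k, μ (c k) * R ^ k ≤ w k) → ∀ k,
      μ (∑ p ∈ Finset.HasAntidiagonal.antidiagonal k, c p.1 * c' p.2) * R ^ k
        ≤ ∑ p ∈ Finset.HasAntidiagonal.antidiagonal k, w p.1 * u' p.2 := by
    intro μ w hμ w0 hw k
    refine (mul_le_mul_of_nonneg_right (Finset.le_sum_of_subadditive μ (map_zero μ).le
      (map_add_le_add μ) _ _) (by positivity)).trans ?_
    rw [Finset.sum_mul]
    refine Finset.sum_le_sum fun p hp => ?_
    rw [← Finset.HasAntidiagonal.mem_antidiagonal.mp hp, pow_add]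
    calc μ (c p.1 * c' p.2) * (R ^ p.1 * R ^ p.2)
        ≤ (μ (c p.1) * ‖c' p.2‖) * (R ^ p.1 * R ^ p.2) :=
          mul_le_mul_of_nonneg_right (hμ _ _) (by positivity)
      _ = (μ (c p.1) * R ^ p.1) * (‖c' p.2‖ * R ^ p.2) := by ring
      _ ≤ w p.1 * u' p.2 := mul_le_mul (hw _) (hcu' _) (by positivity) (w0 _)
  refine ⟨fun k => ∑ p ∈ Finset.HasAntidiagonal.antidiagonal k, c p.1 * c' p.2, _, _, fun k => ?_, ?_,
    key (normSeminorm ℂ 𝔸) u norm_mul_le u0 hcu, hasSum_antidiagonal hu hu' u0 u0',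
    key ν v hν.mul_le_mul_norm v0 hcv, hasSum_antidiagonal hv hu' v0 u0'⟩
  · refine Submodule.sum_mem _ fun p hp => ?_
    rw [← Finset.HasAntidiagonal.mem_antidiagonal.mp hp, pow_add]
    exact Submodule.mul_mem_mul (hc _) (hc' _)
  · rw [← hcs.tsum_eq, ← hcs'.tsum_eq, tsum_mul_tsum_eq_tsum_sum_antidiagonal_of_summable_norm n1 n2]
    exact (summable_norm_sum_mul_antidiagonal_of_summable_norm n1 n2).of_norm.hasSum

theorem HasWeightedExpansion.pow_succ [CompleteSpace 𝔸] {V : Submodule ℂ 𝔸} {ν : Seminorm ℂ 𝔸}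
    (hν : IsIdealSeminorm ν) {R a f : ℝ} {x : 𝔸} (hR : 1 ≤ R)
    (hx : HasWeightedExpansion V ν R a f x) (j : ℕ) :
    HasWeightedExpansion V ν R (a ^ (j + 1)) (f * a ^ j) (x ^ (j + 1)) := by
  induction j with
  | zero => simpa using hx
  | succ j ih =>
    rw [pow_succ' x, pow_succ' a (j + 1)]
    exact hx.mul hν hR ih

/-- The terms of degree above `N` carry weight at least `R ^ (N + 1)`, which bounds the tail; `1 ∈
V` places all lower degrees in `V ^ N`. -/
theorem HasWeightedExpansion.exists_approx {V : Submodule ℂ 𝔸} (hV : (1 : 𝔸) ∈ V)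
    {ν : Seminorm ℂ 𝔸} (hν : IsIdealSeminorm ν) {R a f : ℝ} {x : 𝔸} (hR : 1 ≤ R)
    (hx : HasWeightedExpansion V ν R a f x) (N : ℕ) :
    ∃ b ∈ V ^ N, ν (x - b) ≤ f / R ^ (N + 1) := by
  obtain ⟨c, u, v, hc, hcs, -, -, hcv, hv⟩ := hx
  have hR0 : 0 < R := by linarith
  have v0 : ∀ k, 0 ≤ v k := fun k =>
    (mul_nonneg (apply_nonneg ν _) (by positivity) : 0 ≤ ν (c k) * R ^ k).trans (hcv k)
  have hV1 : (1 : Submodule ℂ 𝔸) ≤ V := Submodule.one_le.mpr hV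
  refine ⟨∑ k ∈ Finset.range (N + 1), c k, Submodule.sum_mem _ fun k hk =>
    pow_le_pow_right' hV1 (Nat.lt_succ_iff.mp (Finset.mem_range.mp hk)) (hc k), ?_⟩
  have h1 : HasSum (fun k => c (k + (N + 1))) (x - ∑ k ∈ Finset.range (N + 1), c k) :=
    (hasSum_nat_add_iff' (N + 1)).mpr hcs
  have h2 : HasSum (fun k => v (k + (N + 1)) / R ^ (N + 1))
      ((f - ∑ k ∈ Finset.range (N + 1), v k) / R ^ (N + 1)) :=
    ((hasSum_nat_add_iff' (N + 1)).mpr hv).div_const _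
  refine (hν.le_of_hasSum h1 (fun k => ?_) h2).trans ?_
  · rw [le_div_iff₀ (by positivity)]
    refine (mul_le_mul_of_nonneg_left ?_ (apply_nonneg ν _)).trans (hcv _)
    exact pow_le_pow_right₀ hR (Nat.le_add_left _ _)
  · gcongr
    exact sub_le_self _ (Finset.sum_nonneg fun k _ => v0 k)

theorem HasWeightedExpansion.seminorm_le {V : Submodule ℂ 𝔸} {ν : Seminorm ℂ 𝔸}
    (hν : IsIdealSeminorm ν) {R a f : ℝ} {x : 𝔸} (hR : 1 ≤ R)
    (hx : HasWeightedExpansion V ν R a f x) : ν x ≤ f := by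
  obtain ⟨c, u, v, -, hcs, -, -, hcv, hv⟩ := hx
  exact hν.le_of_hasSum hcs (fun k => norm_le_of_mul_pow_le (apply_nonneg ν _) hR (hcv k)) hv

theorem hasSum_real_exp (r : ℝ) : HasSum (fun k : ℕ => r ^ k / k.factorial) (Real.exp r) := by
  simpa [Real.exp_eq_exp_ℝ, div_eq_inv_mul] using exp_series_hasSum_exp' (𝕂 := ℝ) r

theorem hasWeightedExpansion_exp [CompleteSpace 𝔸] [NormOneClass 𝔸] {V : Submodule ℂ 𝔸}
    {ν : Seminorm ℂ 𝔸} (hν : IsIdealSeminorm ν) {R r : ℝ} (hR : 1 ≤ R) {x : 𝔸} (hx : x ∈ V)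
    (hxr : R * ‖x‖ ≤ r) :
    HasWeightedExpansion V ν R (Real.exp r) (ν 1 * Real.exp r) (exp x) := by
  have key : ∀ k, ‖((k.factorial : ℂ)⁻¹ • x ^ k)‖ * R ^ k ≤ r ^ k / k.factorial := by
    intro k
    rw [norm_smul, norm_inv, Complex.norm_natCast, div_eq_inv_mul, mul_assoc]
    gcongr
    refine (mul_le_mul_of_nonneg_right (norm_pow_le x k) (by positivity)).trans ?_
    rw [← mul_pow, mul_comm]
    gcongr
  refine ⟨fun k => (k.factorial : ℂ)⁻¹ • x ^ k, fun k => r ^ k / k.factorial,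
    fun k => ν 1 * (r ^ k / k.factorial),
    fun k => Submodule.smul_mem _ _ (Submodule.pow_mem_pow _ hx k),
    exp_series_hasSum_exp' x, key, hasSum_real_exp r, fun k => ?_, (hasSum_real_exp r).mul_left _⟩
  refine (mul_le_mul_of_nonneg_right (hν.le_norm _) (by positivity)).trans ?_
  rw [mul_assoc]
  exact mul_le_mul_of_nonneg_left (key k) (apply_nonneg ν _)

theorem hasWeightedExpansion_exp_sub_exp [CompleteSpace 𝔸] [NormOneClass 𝔸] {V : Submodule ℂ 𝔸}
    {ν : Seminorm ℂ 𝔸} (hν : IsIdealSeminorm ν) {R q : ℝ} (hR : 1 ≤ R) {x y : 𝔸} (hx : x ∈ V)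
    (hy : y ∈ V) (hxq : ‖x‖ ≤ q) (hyq : ‖y‖ ≤ q) :
    HasWeightedExpansion V ν R (R * ‖x - y‖ * Real.exp (R * q)) (R * ν (x - y) * Real.exp (R * q))
      (exp x - exp y) := by
  have hq : 0 ≤ q := (norm_nonneg x).trans hxq
  set c : ℕ → 𝔸 := fun k => (k.factorial : ℂ)⁻¹ • x ^ k - (k.factorial : ℂ)⁻¹ • y ^ k with hc
  -- The constant terms of the two exponentials cancel, so the majorant starts in degree 1; this
  -- shift produces the prefactor `R`.
  set w : ℝ → ℕ → ℝ := fun δ k =>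
    Nat.casesOn k 0 fun k => R * δ * ((R * q) ^ k / k.factorial) with hw
  have hws : ∀ δ, HasSum (w δ) (R * δ * Real.exp (R * q)) := fun δ => by
    rw [← hasSum_nat_add_iff' 1]
    simpa [hw] using (hasSum_real_exp (R * q)).mul_left (R * δ)
  have key : ∀ μ : Seminorm ℂ 𝔸, IsIdealSeminorm μ → ∀ k, μ (c k) * R ^ k ≤ w (μ (x - y)) k := by
    intro μ hμ k
    cases k with
    | zero => simp [hc, hw]
    | succ k =>
      have e : c (k + 1) = (((k + 1).factorial : ℂ)⁻¹) • (x ^ (k + 1) - y ^ (k + 1)) := by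
        simp [hc, smul_sub]
      rw [e, map_smul_eq_mul, norm_inv, Complex.norm_natCast]
      have h := hμ.pow_sub_pow_le hxq hyq k
      calc ((k + 1).factorial : ℝ)⁻¹ * μ (x ^ (k + 1) - y ^ (k + 1)) * R ^ (k + 1)
          ≤ ((k + 1).factorial : ℝ)⁻¹ * ((k + 1) * q ^ k * μ (x - y)) * R ^ (k + 1) := by gcongr
        _ = R * μ (x - y) * ((R * q) ^ k / k.factorial) := by
          rw [Nat.factorial_succ]; push_cast; field_simp; ring
  refine ⟨c, w ‖x - y‖, w (ν (x - y)), fun k => ?_, ?_, key (normSeminorm ℂ 𝔸)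
    isIdealSeminorm_normSeminorm, hws _, key ν hν, hws _⟩
  · exact sub_mem (Submodule.smul_mem _ _ (Submodule.pow_mem_pow _ hx k))
      (Submodule.smul_mem _ _ (Submodule.pow_mem_pow _ hy k))
  · exact (exp_series_hasSum_exp' x).sub (exp_series_hasSum_exp' y)

theorem hasWeightedExpansion_exp_mul_exp_neg_sub_one [CompleteSpace 𝔸] [NormOneClass 𝔸]
    {V : Submodule ℂ 𝔸} {ν : Seminorm ℂ 𝔸} (hν : IsIdealSeminorm ν) {R q : ℝ} (hR : 1 ≤ R)
    {x y : 𝔸} (hx : x ∈ V) (hy : y ∈ V) (hxq : ‖x‖ ≤ q) (hyq : ‖y‖ ≤ q) :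
    HasWeightedExpansion V ν R (R * ‖x - y‖ * Real.exp (2 * (R * q)))
      (R * ν (x - y) * Real.exp (2 * (R * q))) (exp x * exp (-y) - 1) := by
  have h : exp x * exp (-y) - 1 = (exp x - exp y) * exp (-y) := by
    let _ : NormedAlgebra ℚ 𝔸 := NormedAlgebra.restrictScalars ℚ ℂ 𝔸
    rw [sub_mul, ← exp_add_of_commute (Commute.neg_right (Commute.refl y))]
    simp
  rw [h, two_mul, Real.exp_add, ← mul_assoc, ← mul_assoc]
  refine (hasWeightedExpansion_exp_sub_exp hν hR hx hy hxq hyq).mul hν hR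
    (hasWeightedExpansion_exp hν hR (neg_mem hy) ?_)
  rw [norm_neg]
  gcongr

/-- The partial sum of degree `N` of the series for `log (1 + x)`. -/
noncomputable def logPartialSum (N : ℕ) (x : 𝔸) : 𝔸 :=
  ∑ j ∈ Finset.range (N + 1), ((-1 : ℂ) ^ (j + 1) / j) • x ^ j

theorem logPartialSum_eq (N : ℕ) (x : 𝔸) :
    logPartialSum N x = ∑ j ∈ Finset.range N, ((-1 : ℂ) ^ j / (j + 1)) • x ^ (j + 1) := by
  rw [logPartialSum, Finset.sum_range_succ']
  simp [pow_succ]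

theorem norm_neg_one_pow_div_le_one (j : ℕ) : ‖(-1 : ℂ) ^ j / (j + 1)‖ ≤ 1 := by
  rw [norm_div, norm_pow, norm_neg, norm_one, one_pow]
  have : ‖(j : ℂ) + 1‖ = j + 1 := by exact_mod_cast Complex.norm_natCast (j + 1)
  rw [this, div_le_one (by positivity)]
  linarith [(Nat.cast_nonneg j : (0 : ℝ) ≤ j)]

/-- Each power of `x` is truncated separately. As `a ≤ 1 / 2`, the errors form a geometric series,
whose sum gives the factor 2. -/
theorem HasWeightedExpansion.exists_approx_logPartialSum [CompleteSpace 𝔸] {V : Submodule ℂ 𝔸}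
    (hV : (1 : 𝔸) ∈ V) {ν : Seminorm ℂ 𝔸} (hν : IsIdealSeminorm ν) {R a f : ℝ} {x : 𝔸}
    (hR : 1 ≤ R) (ha0 : 0 ≤ a) (ha : a ≤ 1 / 2) (hf : 0 ≤ f)
    (hx : HasWeightedExpansion V ν R a f x) (N : ℕ) :
    ∃ b ∈ V ^ N, ν (logPartialSum N x - b) ≤ 2 * (f / R ^ (N + 1)) := by
  choose b hb hxb using fun j => (hx.pow_succ hν hR j).exists_approx hV hν hR N
  refine ⟨∑ j ∈ Finset.range N, ((-1 : ℂ) ^ j / (j + 1)) • b j,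
    Submodule.sum_mem _ fun j _ => Submodule.smul_mem _ _ (hb j), ?_⟩
  rw [logPartialSum_eq, ← Finset.sum_sub_distrib]
  refine (Finset.le_sum_of_subadditive ν (map_zero ν).le (map_add_le_add ν) _ _).trans ?_
  have h : ∀ j ∈ Finset.range N, ν (((-1 : ℂ) ^ j / (j + 1)) • x ^ (j + 1) -
      ((-1 : ℂ) ^ j / (j + 1)) • b j) ≤ (1 / 2) ^ j * (f / R ^ (N + 1)) := by
    intro j _
    rw [← smul_sub, map_smul_eq_mul]
    refine (mul_le_of_le_one_left (apply_nonneg ν _) (norm_neg_one_pow_div_le_one j)).trans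
      ((hxb j).trans ?_)
    rw [mul_comm f, mul_div_assoc]
    gcongr
  refine (Finset.sum_le_sum h).trans ?_
  rw [← Finset.sum_mul]
  gcongr
  exact (Summable.sum_le_tsum _ (fun _ _ => by positivity) summable_geometric_two).trans_eq
    tsum_geometric_two

end Expansion

/-! ### The principal logarithm in a C⋆-algebra -/

section CStar

variable {A : Type*} [CStarAlgebra A]

theorem norm_sub_one_le_of_mem_spectrum {u : A} [IsStarNormal u] {z : ℂ}
    (hz : z ∈ spectrum ℂ u) : ‖z - 1‖ ≤ ‖u - 1‖ := by
  rw [← cfc_id' ℂ u, ← cfc_one ℂ u, ← cfc_sub ..]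
  exact norm_apply_le_norm_cfc (fun z ↦ z - 1) u hz

theorem logPartialSum_sub_one_eq_cfc (u : A) [IsStarNormal u] (N : ℕ) :
    logPartialSum N (u - 1) = cfc (fun z : ℂ => Complex.logTaylor (N + 1) (z - 1)) u := by
  have h1 : cfc (fun z : ℂ => z - 1) u = u - 1 := by
    rw [cfc_sub .., cfc_id' ℂ u, cfc_const_one ℂ u]
  have e : (fun z : ℂ => Complex.logTaylor (N + 1) (z - 1)) =
      ∑ j ∈ Finset.range (N + 1), fun z : ℂ => ((-1) ^ (j + 1) / j) * (z - 1) ^ j := by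
    ext z
    simp only [Complex.logTaylor, Finset.sum_apply]
    exact Finset.sum_congr rfl fun j _ => by ring
  rw [e, cfc_sum _ _ _ (fun j _ => by fun_prop), logPartialSum]
  refine Finset.sum_congr rfl fun j _ => ?_
  rw [cfc_const_mul _ _ _ (by fun_prop), cfc_pow _ _ _ (by fun_prop), h1]

/-- The norm bound keeps the spectrum of `x` in the strip `|im z| < π`, where `log (exp z) = z`; the
second bound keeps the spectrum of `exp x` in the slit plane, where `log` is continuous. -/
theorem eq_cfc_log_exp {x : A} [IsStarNormal x] (hx : ‖x‖ < Real.pi) (hx1 : ‖exp x - 1‖ < 1) :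
    x = cfc Complex.log (exp x) := by
  obtain (_ | _) := subsingleton_or_nontrivial A
  · exact Subsingleton.elim _ _
  have hu : exp x = cfc Complex.exp x := (CFC.complex_exp_eq_normedSpace_exp (a := x)).symm
  have hn : IsStarNormal (exp x) := hu ▸ cfc_predicate Complex.exp x
  have hc : ContinuousOn Complex.log (Complex.exp '' spectrum ℂ x) := by
    rw [← cfc_map_spectrum Complex.exp x, ← hu]
    intro z hz
    refine (continuousAt_clog ?_).continuousWithinAt
    have := (norm_sub_one_le_of_mem_spectrum hz).trans_lt hx1
    simpa using Complex.mem_slitPlane_of_norm_lt_one this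
  rw [hu, ← cfc_comp' Complex.log Complex.exp x hc]
  conv_lhs => rw [← cfc_id' ℂ x]
  refine cfc_congr fun z hz => ?_
  have h1 : |z.im| < Real.pi :=
    (Complex.abs_im_le_norm z).trans_lt ((spectrum.norm_le_norm_of_mem hz).trans_lt hx)
  rw [abs_lt] at h1
  exact (Complex.log_exp h1.1 h1.2.le).symm

/-- The functional calculus transfers the scalar Taylor remainder of `log` to `exp x`. -/
theorem norm_sub_logPartialSum_le {x : A} [IsStarNormal x] (hx : ‖x‖ < Real.pi)
    (hx1 : ‖exp x - 1‖ ≤ 1 / 2) (N : ℕ) :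
    ‖x - logPartialSum N (exp x - 1)‖ ≤ 2 * (1 / 2) ^ (N + 1) := by
  have hu : exp x = cfc Complex.exp x := (CFC.complex_exp_eq_normedSpace_exp (a := x)).symm
  have hn : IsStarNormal (exp x) := hu ▸ cfc_predicate Complex.exp x
  have hz : ∀ z ∈ spectrum ℂ (exp x), ‖z - 1‖ ≤ 1 / 2 := fun z hz =>
    (norm_sub_one_le_of_mem_spectrum hz).trans hx1
  have hc : ContinuousOn Complex.log (spectrum ℂ (exp x)) := fun z hzs => by
    refine (continuousAt_clog ?_).continuousWithinAt
    simpa using Complex.mem_slitPlane_of_norm_lt_one ((hz z hzs).trans_lt (by norm_num))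
  have hc' : Continuous fun z : ℂ => Complex.logTaylor (N + 1) (z - 1) := by
    unfold Complex.logTaylor; fun_prop
  have e : x - logPartialSum N (exp x - 1) =
      cfc (fun z => Complex.log z - Complex.logTaylor (N + 1) (z - 1)) (exp x) := by
    rw [cfc_sub _ _ _ hc hc'.continuousOn, ← eq_cfc_log_exp hx (hx1.trans_lt (by norm_num)),
      logPartialSum_sub_one_eq_cfc]
  rw [e]
  refine norm_cfc_le (by positivity) fun z hzs => ?_
  have h := hz z hzs
  have := Complex.norm_log_sub_logTaylor_le N (z := z - 1) (h.trans_lt (by norm_num))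
  rw [add_sub_cancel] at this
  refine this.trans ?_
  have h2 : (1 - ‖z - 1‖)⁻¹ ≤ 2 := by
    rw [inv_le_comm₀ (by linarith) (by norm_num)]; linarith
  calc ‖z - 1‖ ^ (N + 1) * (1 - ‖z - 1‖)⁻¹ / (N + 1)
      ≤ ‖z - 1‖ ^ (N + 1) * (1 - ‖z - 1‖)⁻¹ := div_le_self
        (mul_nonneg (by positivity) (inv_nonneg.mpr (by linarith))) (by linarith [(Nat.cast_nonneg N : (0:ℝ) ≤ N)])
    _ ≤ (1 / 2) ^ (N + 1) * 2 := by
        gcongr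
        exact inv_nonneg.mpr (by linarith)
    _ = _ := by ring

theorem hasSum_log {x : A} [IsStarNormal x] (hx : ‖x‖ < Real.pi) (hx1 : ‖exp x - 1‖ ≤ 1 / 2) :
    HasSum (fun j : ℕ => ((-1 : ℂ) ^ j / (j + 1)) • (exp x - 1) ^ (j + 1)) x := by
  obtain (_ | _) := subsingleton_or_nontrivial A
  · convert hasSum_zero using 1
  have hs : Summable fun j : ℕ => ((-1 : ℂ) ^ j / (j + 1)) • (exp x - 1) ^ (j + 1) := by
    refine Summable.of_norm_bounded summable_geometric_two fun j => ?_
    rw [norm_smul]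
    refine (mul_le_of_le_one_left (norm_nonneg _) (norm_neg_one_pow_div_le_one j)).trans
      ((norm_pow_le _ _).trans ?_)
    calc ‖exp x - 1‖ ^ (j + 1) ≤ (1 / 2 : ℝ) ^ (j + 1) := by gcongr
      _ ≤ (1 / 2) ^ j := pow_le_pow_of_le_one (by norm_num) (by norm_num) (Nat.le_succ j)
  rw [hs.hasSum_iff_tendsto_nat, tendsto_iff_norm_sub_tendsto_zero]
  refine squeeze_zero (fun _ => norm_nonneg _) (fun N => ?_)
    (g := fun N : ℕ => 2 * (1 / 2 : ℝ) ^ (N + 1)) ?_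
  · rw [← logPartialSum_eq, norm_sub_rev]
    exact norm_sub_logPartialSum_le hx hx1 N
  · simpa using ((tendsto_pow_atTop_nhds_zero_of_lt_one (r := (1 / 2 : ℝ)) (by norm_num)
      (by norm_num)).comp (Filter.tendsto_add_atTop_nat 1)).const_mul 2

/-- Norm convergence alone would lose the factor `ν (exp x - 1)`; summing the tail of the series
term by term in `ν` retains it. -/
theorem seminorm_sub_logPartialSum_le {ν : Seminorm ℂ A} (hν : IsIdealSeminorm ν) {x : A}
    [Nontrivial A] [IsStarNormal x] (hx : ‖x‖ < Real.pi) (hx1 : ‖exp x - 1‖ ≤ 1 / 2) (N : ℕ) :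
    ν (x - logPartialSum N (exp x - 1)) ≤ 2 * ν (exp x - 1) * ‖exp x - 1‖ ^ N := by
  have h := (hasSum_nat_add_iff' (G := A)
    (f := fun j : ℕ => ((-1 : ℂ) ^ j / (j + 1)) • (exp x - 1) ^ (j + 1)) N).mpr (hasSum_log hx hx1)
  rw [← logPartialSum_eq] at h
  have hg := hasSum_geometric_two.mul_left (ν (exp x - 1) * ‖exp x - 1‖ ^ N)
  have hν0 := apply_nonneg ν (exp x - 1)
  set E := exp x - 1
  have hterm : ∀ k : ℕ, ν (((-1 : ℂ) ^ (k + N) / ((k + N : ℕ) + 1)) • E ^ (k + N + 1)) ≤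
      ν E * ‖E‖ ^ N * (1 / 2) ^ k := fun k => by
    rw [map_smul_eq_mul]
    calc _ ≤ ν ((exp x - 1) ^ (k + N + 1)) :=
          mul_le_of_le_one_left (apply_nonneg ν _) (norm_neg_one_pow_div_le_one (k + N))
      _ ≤ ν (exp x - 1) * ‖exp x - 1‖ ^ (k + N) := hν.pow_succ_le _ _
      _ = ν (exp x - 1) * ‖exp x - 1‖ ^ N * ‖exp x - 1‖ ^ k := by ring
      _ ≤ _ := by gcongr
  exact (hν.le_of_hasSum h hterm hg).trans_eq (by ring)

theorem exists_unique_log {u : A} (hu : u ∈ unitary A) (hu1 : ‖u - 1‖ ≤ 1 / 2) :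
    ∃! W : A, IsSelfAdjoint W ∧ ‖W‖ < Real.pi ∧ exp (-(Complex.I • W)) = u := by
  have hlt : ‖u - 1‖ < 2 := hu1.trans_lt (by norm_num)
  set x := Unitary.argSelfAdjoint (⟨u, hu⟩ : unitary A) with hx
  have hexp : exp (Complex.I • (x : A)) = u :=
    congrArg Subtype.val (expUnitary_argSelfAdjoint (u := ⟨u, hu⟩) hlt)
  refine ⟨-(x : A), ⟨x.2.neg, ?_, by simpa using hexp⟩, ?_⟩
  · rw [norm_neg]
    have h1 : ‖x‖ ≤ Real.pi := Unitary.norm_argSelfAdjoint_le_pi _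
    refine lt_of_le_of_ne h1 fun h => ?_
    replace h : ‖x‖ = Real.pi := h
    -- Argument norm `π` would force `‖u - 1‖ ^ 2 = 2 * (1 - cos π) = 4`.
    have h2 := Unitary.two_mul_one_sub_cos_norm_argSelfAdjoint (u := (⟨u, hu⟩ : unitary A)) hlt
    rw [← hx, h] at h2
    norm_num at h2
    nlinarith [norm_nonneg (u - 1)]
  · rintro W ⟨hW, hWπ, hWu⟩
    let y : selfAdjoint A := ⟨-W, hW.neg⟩
    have hy : selfAdjoint.expUnitary y = ⟨u, hu⟩ := by
      ext
      simpa [y] using hWu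
    have := argSelfAdjoint_expUnitary (x := y) (by simpa [y] using hWπ)
    rw [hy, ← hx] at this
    rw [this]; simp [y]

end CStar

open scoped Matrix.Norms.L2Operator Pointwise

/-! ### Pauli strings: orthogonality, norms and sparsity of products -/

section Pauli

variable {n : ℕ}

theorem opNorm_eq_norm (A : QMatrix n) : opNorm A = ‖A‖ := rfl

theorem pauli_conj_apply (i : Fin 4) (a b : Fin 2) : star (pauli i a b) = pauli i b a := by
  fin_cases i <;> fin_cases a <;> fin_cases b <;> simp [pauli]

theorem pauli_mul_self (i : Fin 4) : pauli i * pauli i = 1 := by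
  ext a b
  fin_cases i <;> fin_cases a <;> fin_cases b <;> simp [pauli, Matrix.mul_apply, Fin.sum_univ_two]

theorem exists_pauli_mul_eq_smul (i j : Fin 4) :
    ∃ (c : ℂ) (k : Fin 4), pauli i * pauli j = c • pauli k := by
  -- Up to a phase, the Pauli matrices form the Klein four-group, which is bitwise xor on the labels
  -- `0, 1, 2, 3`.
  have h : ∃ c : ℂ, pauli i * pauli j = c • pauli (i ^^^ j) := by
    fin_cases i <;> fin_cases j <;>
      first
      | refine ⟨1, ?_⟩
        ext a b
        fin_cases a <;> fin_cases b <;> simp [pauli, Matrix.mul_apply, Fin.sum_univ_two] <;> done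
      | refine ⟨Complex.I, ?_⟩
        ext a b
        fin_cases a <;> fin_cases b <;> simp [pauli, Matrix.mul_apply, Fin.sum_univ_two] <;> done
      | refine ⟨-Complex.I, ?_⟩
        ext a b
        fin_cases a <;> fin_cases b <;> simp [pauli, Matrix.mul_apply, Fin.sum_univ_two]
  exact ⟨h.choose, _, h.choose_spec⟩

theorem trace_pauli_mul (i j : Fin 4) :
    (pauli i * pauli j).trace = if i = j then 2 else 0 := by
  fin_cases i <;> fin_cases j <;>
    norm_num [pauli, Matrix.trace, Matrix.mul_apply, Fin.sum_univ_two]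

/-- The completeness relation: the sum of `P ⊗ P` is twice the swap. Its tensor power yields the
Pauli expansion of any matrix. -/
theorem sum_pauli_apply_mul_pauli_apply (a b c d : Fin 2) :
    ∑ i, pauli i a b * pauli i c d = if a = d ∧ b = c then 2 else 0 := by
  fin_cases a <;> fin_cases b <;> fin_cases c <;> fin_cases d <;>
    simp [pauli, Fin.sum_univ_four] <;> norm_num

theorem pauliString_mul_apply (x y : Fin n → Fin 4) (a b : Fin n → Fin 2) :
    (pauliString x * pauliString y) a b = ∏ i, (pauli (x i) * pauli (y i)) (a i) (b i) := by
  simp only [Matrix.mul_apply, pauliString, Matrix.of_apply, ← Finset.prod_mul_distrib]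
  exact (Fintype.prod_sum fun i k => pauli (x i) (a i) k * pauli (y i) k (b i)).symm

theorem pauliString_conjTranspose (x : Fin n → Fin 4) :
    (pauliString x).conjTranspose = pauliString x := by
  ext a b
  simp only [pauliString, Matrix.conjTranspose_apply, Matrix.of_apply, star_prod, pauli_conj_apply]

theorem pauliString_mul_self (x : Fin n → Fin 4) : pauliString x * pauliString x = 1 := by
  ext a b
  simp only [pauliString_mul_apply, pauli_mul_self, Matrix.one_apply, Finset.prod_ite_zero,
    Finset.prod_const_one, Finset.mem_univ, true_implies, funext_iff]

theorem pauliString_zero : pauliString (0 : Fin n → Fin 4) = 1 := by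
  have h : pauli 0 = 1 := by
    ext a b
    fin_cases a <;> fin_cases b <;> simp [pauli]
  ext a b
  simp only [pauliString, Matrix.of_apply, Pi.zero_apply, h, Matrix.one_apply, Finset.prod_ite_zero,
    Finset.prod_const_one, Finset.mem_univ, true_implies, funext_iff]

theorem exists_pauliString_mul_eq_smul (x y : Fin n → Fin 4) :
    ∃ (c : ℂ) (z : Fin n → Fin 4), pauliString x * pauliString y = c • pauliString z := by
  choose c k h using exists_pauli_mul_eq_smul
  refine ⟨∏ i, c (x i) (y i), fun i => k (x i) (y i), ?_⟩
  ext a b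
  rw [pauliString_mul_apply]
  simp only [h, Matrix.smul_apply, pauliString, Matrix.of_apply, smul_eq_mul,
    Finset.prod_mul_distrib]

theorem trace_pauliString_mul (x y : Fin n → Fin 4) :
    (pauliString x * pauliString y).trace = if x = y then 2 ^ n else 0 := by
  simp only [Matrix.trace, Matrix.diag_apply, pauliString_mul_apply]
  rw [← Fintype.prod_sum fun i k => (pauli (x i) * pauli (y i)) k k]
  have h : ∀ i, ∑ k, (pauli (x i) * pauli (y i)) k k = if x i = y i then 2 else 0 := fun i =>
    trace_pauli_mul (x i) (y i)
  simp only [h, Finset.prod_ite_zero, Finset.prod_const, Finset.mem_univ, true_implies, funext_iff,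
    Finset.card_univ, Fintype.card_fin]

theorem sum_pauliString_apply_mul (a b c d : Fin n → Fin 2) :
    ∑ x, pauliString x a b * pauliString x c d = if a = d ∧ b = c then 2 ^ n else 0 := by
  simp only [pauliString, Matrix.of_apply, ← Finset.prod_mul_distrib]
  rw [← Fintype.prod_sum fun i k => pauli k (a i) (b i) * pauli k (c i) (d i)]
  simp only [sum_pauli_apply_mul_pauli_apply, Finset.prod_ite_zero, Finset.prod_const,
    Finset.mem_univ, true_implies, funext_iff, Finset.card_univ, Fintype.card_fin, forall_and]

/-- The Pauli coefficient as a linear functional. -/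
noncomputable def pauliCoeffLinear (x : Fin n → Fin 4) : QMatrix n →ₗ[ℂ] ℂ where
  toFun A := pauliCoeff A x
  map_add' A B := by simp [pauliCoeff, mul_add, add_div]
  map_smul' c A := by simp [pauliCoeff, mul_div_assoc]

theorem pauliCoeffLinear_apply (x : Fin n → Fin 4) (A : QMatrix n) :
    pauliCoeffLinear x A = pauliCoeff A x := rfl

theorem pauliCoeff_pauliString (x y : Fin n → Fin 4) :
    pauliCoeff (pauliString y) x = if x = y then 1 else 0 := by
  rw [pauliCoeff, trace_pauliString_mul]
  split_ifs <;> simp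

theorem pauliCoeff_conjTranspose (A : QMatrix n) (x : Fin n → Fin 4) :
    pauliCoeff A.conjTranspose x = star (pauliCoeff A x) := by
  have h : (pauliString x * A.conjTranspose).trace = star (pauliString x * A).trace := by
    rw [← Matrix.trace_conjTranspose, Matrix.conjTranspose_mul, pauliString_conjTranspose,
      Matrix.trace_mul_comm]
  simp [pauliCoeff, h]

theorem sum_pauliCoeff_smul (A : QMatrix n) : ∑ x, pauliCoeff A x • pauliString x = A := by
  ext c d
  have h : ∀ x : Fin n → Fin 4, pauliCoeff A x * pauliString x c d =
      ∑ a, ∑ b, A b a * (pauliString x a b * pauliString x c d) / 2 ^ n := fun x => by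
    simp only [pauliCoeff, Matrix.trace, Matrix.diag_apply, Matrix.mul_apply, Finset.sum_mul,
      Finset.sum_div]
    refine Finset.sum_congr rfl fun a _ => Finset.sum_congr rfl fun b _ => ?_
    ring
  simp only [Matrix.sum_apply, Matrix.smul_apply, smul_eq_mul, h]
  rw [Finset.sum_comm]
  simp_rw [Finset.sum_comm (s := (Finset.univ : Finset (Fin n → Fin 4))), ← Finset.sum_div,
    ← Finset.mul_sum, sum_pauliString_apply_mul]
  simp [ite_and, Finset.sum_ite_eq']

theorem sum_norm_sq_pauliCoeff (A : QMatrix n) :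
    ∑ x, ‖pauliCoeff A x‖ ^ 2 = (∑ a, ∑ b, ‖A a b‖ ^ 2) / 2 ^ n := by
  have h1 : (A.conjTranspose * A).trace = ∑ a, ∑ b, (‖A a b‖ ^ 2 : ℂ) := by
    rw [Finset.sum_comm]
    simp [Matrix.trace, Matrix.mul_apply, Complex.conj_mul']
  have h2 : (A.conjTranspose * A).trace = 2 ^ n * ∑ x, (‖pauliCoeff A x‖ ^ 2 : ℂ) := by
    conv_lhs => rw [← sum_pauliCoeff_smul A, sum_pauliCoeff_smul A]
    conv_lhs =>
      enter [1, 2]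
      rw [← sum_pauliCoeff_smul A]
    rw [Finset.mul_sum, Matrix.trace_sum, Finset.mul_sum]
    refine Finset.sum_congr rfl fun x _ => ?_
    have h3 : (A.conjTranspose * pauliString x).trace = 2 ^ n * star (pauliCoeff A x) := by
      rw [← pauliCoeff_conjTranspose, pauliCoeff, Matrix.trace_mul_comm]
      field_simp
    rw [Matrix.mul_smul, Matrix.trace_smul, h3, ← Complex.mul_conj']
    simp only [smul_eq_mul, Complex.star_def]
    ring
  rw [eq_div_iff (by positivity), mul_comm]
  have := h2.symm.trans h1
  exact_mod_cast this

theorem norm_pauliString_le_one (x : Fin n → Fin 4) : ‖pauliString x‖ ≤ 1 := by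
  have h := CStarRing.norm_star_mul_self (x := pauliString x)
  rw [Matrix.star_eq_conjTranspose, pauliString_conjTranspose, pauliString_mul_self, norm_one] at h
  nlinarith [norm_nonneg (pauliString x)]

theorem norm_pauliCoeff_le (A : QMatrix n) (x : Fin n → Fin 4) :
    ‖pauliCoeff A x‖ ≤ pauliLinftyNorm A :=
  le_ciSup (f := fun x => ‖pauliCoeff A x‖) (Set.finite_range _).bddAbove x

theorem sum_le_pauliSparsity_mul (A : QMatrix n) {g : ℂ → ℝ} (hg : g 0 = 0) {δ : ℝ}
    (h : ∀ x, g (pauliCoeff A x) ≤ δ) : ∑ x, g (pauliCoeff A x) ≤ pauliSparsity A * δ := by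
  classical
  have e : pauliSparsity A = (Finset.univ.filter fun x => pauliCoeff A x ≠ 0).card := by
    rw [pauliSparsity, Set.ncard_eq_toFinset_card']
    congr 1
    ext; simp
  rw [e, ← Finset.sum_filter_add_sum_filter_not Finset.univ fun x => pauliCoeff A x ≠ 0]
  have h0 : ∑ x with ¬ pauliCoeff A x ≠ 0, g (pauliCoeff A x) = 0 :=
    Finset.sum_eq_zero fun x hx => by
      rw [Finset.mem_filter, not_not] at hx
      rw [hx.2, hg]
  rw [h0, add_zero, ← nsmul_eq_mul]
  exact Finset.sum_le_card_nsmul _ _ _ fun x _ => h x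

theorem opNorm_le_pauliSparsity_mul (A : QMatrix n) {ε : ℝ} (h : pauliLinftyNorm A ≤ ε) :
    ‖A‖ ≤ pauliSparsity A * ε := by
  conv_lhs => rw [← sum_pauliCoeff_smul A]
  refine (norm_sum_le _ _).trans ((Finset.sum_le_sum fun x _ => ?_).trans
    (sum_le_pauliSparsity_mul A (g := fun z => ‖z‖) norm_zero
      fun x => (norm_pauliCoeff_le A x).trans h))
  rw [norm_smul]
  exact mul_le_of_le_one_right (norm_nonneg _) (norm_pauliString_le_one x)

theorem frobNorm_le_sqrt_pauliSparsity_mul (A : QMatrix n) {ε : ℝ} (hε : 0 ≤ ε)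
    (h : pauliLinftyNorm A ≤ ε) : frobNorm A ≤ Real.sqrt (pauliSparsity A) * ε := by
  rw [frobNorm, ← sum_norm_sq_pauliCoeff, Real.sqrt_le_left (by positivity), mul_pow,
    Real.sq_sqrt (by positivity)]
  refine sum_le_pauliSparsity_mul A (g := fun z => ‖z‖ ^ 2) (by simp) fun x => ?_
  exact pow_le_pow_left₀ (norm_nonneg _) ((norm_pauliCoeff_le A x).trans h) 2

theorem pauliSparsity_sub_le (A B : QMatrix n) :
    pauliSparsity (A - B) ≤ pauliSparsity A + pauliSparsity B := by
  refine (Set.ncard_le_ncard (fun x hx => ?_) (Set.toFinite _)).trans (Set.ncard_union_le _ _)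
  simp only [Set.mem_union, Set.mem_ofPred_eq] at hx ⊢
  by_contra! h
  refine hx ?_
  rw [← pauliCoeffLinear_apply, map_sub, pauliCoeffLinear_apply, pauliCoeffLinear_apply, h.1, h.2,
    sub_zero]

/-- The entries of a matrix as a Euclidean vector. -/
noncomputable def entryVector (A : QMatrix n) : EuclideanSpace ℂ ((Fin n → Fin 2) × (Fin n → Fin 2)) :=
  WithLp.toLp 2 fun p => A p.1 p.2

theorem frobNorm_eq (A : QMatrix n) : frobNorm A = ‖entryVector A‖ / Real.sqrt (2 ^ n) := by
  rw [frobNorm, EuclideanSpace.norm_eq, Real.sqrt_div (by positivity), Fintype.sum_prod_type]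
  rfl

/-- The normalized Frobenius norm as a seminorm. -/
noncomputable def frobSeminorm (n : ℕ) : Seminorm ℂ (QMatrix n) :=
  Seminorm.of frobNorm
    (fun A B => by
      simp only [frobNorm_eq, ← add_div]
      gcongr
      exact norm_add_le (entryVector A) (entryVector B))
    (fun c A => by
      simp only [frobNorm_eq, ← mul_div_assoc]
      congr 1
      exact norm_smul c (entryVector A))

theorem frobSeminorm_apply (A : QMatrix n) : frobSeminorm n A = frobNorm A := rfl

theorem frobNorm_conjTranspose (A : QMatrix n) : frobNorm A.conjTranspose = frobNorm A := by
  rw [frobNorm, frobNorm, Finset.sum_comm]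
  simp

theorem frobNorm_mul_le (A B : QMatrix n) : frobNorm (A * B) ≤ ‖A‖ * frobNorm B := by
  have h : ∑ a, ∑ b, ‖(A * B) a b‖ ^ 2 ≤ ‖A‖ ^ 2 * ∑ a, ∑ b, ‖B a b‖ ^ 2 := by
    rw [Finset.sum_comm, Finset.sum_comm (f := fun a b => ‖B a b‖ ^ 2), Finset.mul_sum]
    refine Finset.sum_le_sum fun b _ => ?_
    have := pow_le_pow_left₀ (norm_nonneg _)
      (Matrix.l2_opNorm_mulVec A (WithLp.toLp 2 fun k => B k b)) 2
    rw [mul_pow, EuclideanSpace.norm_sq_eq, EuclideanSpace.norm_sq_eq] at this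
    exact this
  rw [frobNorm, frobNorm, ← Real.sqrt_sq (norm_nonneg A), ← Real.sqrt_mul (sq_nonneg _),
    ← mul_div_assoc]
  gcongr

theorem isIdealSeminorm_frobSeminorm (n : ℕ) : IsIdealSeminorm (frobSeminorm n) where
  mul_le_norm_mul := frobNorm_mul_le
  mul_le_mul_norm A B := by
    rw [frobSeminorm_apply, frobSeminorm_apply, ← frobNorm_conjTranspose,
      Matrix.conjTranspose_mul, ← frobNorm_conjTranspose A, mul_comm, ← Matrix.l2_opNorm_conjTranspose B]
    exact frobNorm_mul_le _ _

theorem exists_eq_smul_pauliString_of_mem_pow {s : Set (Fin n → Fin 4)} {N : ℕ} {A : QMatrix n}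
    (hA : A ∈ (pauliString '' s) ^ N) : ∃ (c : ℂ) (x : Fin n → Fin 4), A = c • pauliString x := by
  induction N generalizing A with
  | zero => exact ⟨1, 0, by simpa [pauliString_zero] using hA⟩
  | succ N ih =>
    rw [pow_succ] at hA
    obtain ⟨B, hB, _, ⟨y, -, rfl⟩, rfl⟩ := hA
    obtain ⟨c, x, rfl⟩ := ih hB
    obtain ⟨d, z, h⟩ := exists_pauliString_mul_eq_smul x y
    exact ⟨c * d, z, by simp only [smul_mul_assoc, h, smul_smul]⟩

/-- `V ^ N` is spanned by at most `s.card ^ N` products, each a multiple of one string. The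
coefficient functional of any other string vanishes on the spanning set, hence on the span. -/
theorem pauliSparsity_le_of_mem_span_pow {s : Finset (Fin n → Fin 4)} {N : ℕ} {A : QMatrix n}
    (hA : A ∈ Submodule.span ℂ (pauliString '' (s : Set (Fin n → Fin 4))) ^ N) :
    pauliSparsity A ≤ s.card ^ N := by
  classical
  rw [Submodule.span_pow] at hA
  set F : Finset (QMatrix n) := (s.image pauliString) ^ N with hF
  have hFs : (F : Set (QMatrix n)) = (pauliString '' (s : Set (Fin n → Fin 4))) ^ N := by
    rw [hF, Finset.coe_pow, Finset.coe_image]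
  have hFc : F.card ≤ s.card ^ N :=
    Finset.card_pow_le.trans (Nat.pow_le_pow_left Finset.card_image_le N)
  have h : ∀ B : QMatrix n, ∃ x, B ∈ F → ∃ c : ℂ, B = c • pauliString x := fun B => by
    by_cases hB : B ∈ F
    · obtain ⟨c, x, e⟩ := exists_eq_smul_pauliString_of_mem_pow (hFs ▸ (Finset.mem_coe.mpr hB))
      exact ⟨x, fun _ => ⟨c, e⟩⟩
    · exact ⟨0, fun h => absurd h hB⟩
  choose idx hidx using h
  refine le_trans ?_ ((Finset.card_image_le (f := idx)).trans hFc)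
  rw [← Set.ncard_coe_finset]
  refine Set.ncard_le_ncard (fun x hx => ?_) (Finset.finite_toSet _)
  by_contra hxF
  refine hx ?_
  have hle : Submodule.span ℂ ((pauliString '' (s : Set (Fin n → Fin 4))) ^ N) ≤
      LinearMap.ker (pauliCoeffLinear x) := by
    rw [Submodule.span_le, ← hFs]
    intro B hB
    obtain ⟨c, e⟩ := hidx B hB
    have hne : x ≠ idx B := fun h => hxF (h ▸ Finset.mem_coe.mpr (Finset.mem_image_of_mem idx hB))
    rw [SetLike.mem_coe, LinearMap.mem_ker, e, map_smul, pauliCoeffLinear_apply,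
      pauliCoeff_pauliString, if_neg hne, smul_zero]
  exact hle hA

theorem mem_span_pauliString {s : Set (Fin n → Fin 4)} {A : QMatrix n}
    (h : ∀ x, pauliCoeff A x ≠ 0 → x ∈ s) : A ∈ Submodule.span ℂ (pauliString '' s) := by
  rw [← sum_pauliCoeff_smul A]
  refine Submodule.sum_mem _ fun x _ => ?_
  by_cases hx : pauliCoeff A x = 0
  · simp [hx]
  · exact Submodule.smul_mem _ _ (Submodule.subset_span ⟨x, h x hx, rfl⟩)

theorem exists_span_pauliString (A B : QMatrix n) :
    ∃ s : Finset (Fin n → Fin 4), s.card ≤ pauliSparsity A + pauliSparsity B + 1 ∧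
      1 ∈ Submodule.span ℂ (pauliString '' (s : Set (Fin n → Fin 4))) ∧
      A ∈ Submodule.span ℂ (pauliString '' (s : Set (Fin n → Fin 4))) ∧
      B ∈ Submodule.span ℂ (pauliString '' (s : Set (Fin n → Fin 4))) := by
  classical
  have hs := (Set.toFinite (({x | pauliCoeff A x ≠ 0} ∪ {x | pauliCoeff B x ≠ 0}) ∪ {0}))
  refine ⟨hs.toFinset, ?_, ?_, ?_, ?_⟩
  · rw [← Set.ncard_eq_toFinset_card _ hs]
    refine (Set.ncard_union_le _ _).trans ?_
    rw [Set.ncard_singleton]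
    exact Nat.add_le_add_right (Set.ncard_union_le _ _) 1
  · exact Submodule.subset_span ⟨0, by simp, pauliString_zero⟩
  · exact mem_span_pauliString fun x hx => by simp [hx]
  · exact mem_span_pauliString fun x hx => by simp [hx]

/-- The approximant need not be Hermitian: its Hermitian part is no farther from `W` and has no
additional Pauli terms. -/
theorem pauliQuasiSparsity_le {W B : QMatrix n} (hW : W.IsHermitian) {δ : ℝ}
    (h : frobNorm (W - B) ≤ δ) : pauliQuasiSparsity W δ ≤ pauliSparsity B := by
  set B' : QMatrix n := (2⁻¹ : ℂ) • (B + B.conjTranspose) with hB'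
  have hherm : B'.IsHermitian := by
    rw [Matrix.IsHermitian, hB', Matrix.conjTranspose_smul, Matrix.conjTranspose_add,
      Matrix.conjTranspose_conjTranspose, add_comm]
    simp
  have hdist : frobNorm (W - B') ≤ δ := by
    have e : W - B' = (2⁻¹ : ℂ) • ((W - B) + (W - B).conjTranspose) := by
      rw [Matrix.conjTranspose_sub, hW.eq, hB']
      module
    rw [← frobSeminorm_apply, e, map_smul_eq_mul]
    have := map_add_le_add (frobSeminorm n) (W - B) (W - B).conjTranspose
    simp only [frobSeminorm_apply, frobNorm_conjTranspose] at this
    rw [norm_inv, Complex.norm_ofNat, frobSeminorm_apply]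
    linarith
  have hsp : pauliSparsity B' ≤ pauliSparsity B := by
    refine Set.ncard_le_ncard (fun x hx hB => hx ?_) (Set.toFinite _)
    rw [← pauliCoeffLinear_apply, hB', map_smul, map_add, pauliCoeffLinear_apply,
      pauliCoeffLinear_apply, pauliCoeff_conjTranspose, hB]
    simp
  have hle : pauliQuasiSparsity W δ ≤ pauliSparsity B' := Nat.sInf_le ⟨B', hherm, hdist, rfl⟩
  exact hle.trans hsp

end Pauli

/-! ### Approximating the logarithm of a product of two exponentials -/

section CStar

variable {A : Type*} [CStarAlgebra A]

theorem exp_le_two {r : ℝ} (hr : r ≤ 1 / 4) : Real.exp r ≤ 2 := by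
  have h : Real.exp r ≤ Real.exp 1 ^ (1 / 4 : ℝ) := by
    rw [← Real.exp_mul]; exact Real.exp_le_exp.mpr (by linarith)
  refine h.trans ((Real.rpow_le_rpow (by positivity) (by linarith [Real.exp_one_lt_d9] :
    Real.exp 1 ≤ 4) (by norm_num)).trans ?_)
  calc (4 : ℝ) ^ (1 / 4 : ℝ) ≤ 4 ^ (1 / 2 : ℝ) :=
        Real.rpow_le_rpow_of_exponent_le (by norm_num) (by norm_num)
    _ = 2 := by
      rw [← Real.sqrt_eq_rpow, show (4 : ℝ) = 2 ^ 2 by norm_num, Real.sqrt_sq (by norm_num)]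

theorem seminorm_exp_mul_exp_neg_sub_one_le [Nontrivial A] {ν : Seminorm ℂ A} (hν : IsIdealSeminorm ν)
    {x y : A} {q : ℝ} (hq : q ≤ 1 / 8) (hx : ‖x‖ ≤ q) (hy : ‖y‖ ≤ q) :
    ν (exp x * exp (-y) - 1) ≤ 2 * ν (x - y) := by
  -- With `V = ⊤` and `R = 1` the degree information is void and only the size estimate remains.
  have h := (hasWeightedExpansion_exp_mul_exp_neg_sub_one (V := ⊤) hν le_rfl trivial trivial
    hx hy).seminorm_le hν le_rfl
  refine h.trans ?_
  rw [one_mul, one_mul, mul_comm]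
  exact mul_le_mul_of_nonneg_right (exp_le_two (by linarith)) (apply_nonneg ν _)

/-- The constant `3 / 2` is 1 from truncating degrees plus `1 / 2` from truncating the logarithm. -/
theorem exists_approx_log [Nontrivial A] {ν : Seminorm ℂ A} (hν : IsIdealSeminorm ν)
    {V : Submodule ℂ A} (hV : 1 ∈ V) {x y z : A} {μ : ℝ} (hμ0 : 0 < μ) (hμ1 : μ ≤ 1)
    (hxV : x ∈ V) (hyV : y ∈ V) (hx : ‖x‖ ≤ μ / 32) (hy : ‖y‖ ≤ μ / 32) [IsStarNormal z]
    (hz : ‖z‖ < Real.pi) (hexp : exp z = exp x * exp (-y)) :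
    ν z ≤ 4 * ν (x - y) ∧
      ∀ N : ℕ, 1 ≤ N → ∃ b ∈ V ^ N, ν (z - b) ≤ 3 / 2 * ν (x - y) * μ ^ N := by
  have hδ := apply_nonneg ν (x - y)
  have hxy : ‖x - y‖ ≤ μ / 16 := (norm_sub_le x y).trans (by linarith)
  have hE : ν (exp z - 1) ≤ 2 * ν (x - y) := by
    rw [hexp]
    exact seminorm_exp_mul_exp_neg_sub_one_le hν (by linarith) hx hy
  have hEn : ‖exp z - 1‖ ≤ μ / 8 := by
    have h := seminorm_exp_mul_exp_neg_sub_one_le (A := A) isIdealSeminorm_normSeminorm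
      (by linarith) hx hy
    rw [← hexp] at h
    exact h.trans (by change 2 * ‖x - y‖ ≤ _; linarith)
  have htail := seminorm_sub_logPartialSum_le hν hz (hEn.trans (by linarith))
  refine ⟨?_, fun N hN => ?_⟩
  · have h0 := htail 0
    simp only [logPartialSum_eq, Finset.range_zero, Finset.sum_empty, sub_zero, pow_zero,
      mul_one] at h0
    linarith
  -- The weight `R = 4 / μ` gives decay `(μ / 4) ^ N`, whose spare `4 ^ (-N)` absorbs the constants
  -- once `1 ≤ N`; it also keeps the weighted norm of `exp z - 1` at most `1 / 2`.
  · have hR : 1 ≤ 4 / μ := by rw [le_div_iff₀ hμ0]; linarith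
    have hRq : 2 * (4 / μ * (μ / 32)) = 1 / 4 := by field_simp; norm_num
    have hexp2 : Real.exp (2 * (4 / μ * (μ / 32))) ≤ 2 := exp_le_two hRq.le
    have hexpand := hasWeightedExpansion_exp_mul_exp_neg_sub_one hν hR hxV hyV hx hy
    rw [← hexp] at hexpand
    have ha : 4 / μ * ‖x - y‖ * Real.exp (2 * (4 / μ * (μ / 32))) ≤ 1 / 2 := by
      calc _ ≤ 4 / μ * (μ / 16) * 2 := by gcongr
        _ = 1 / 2 := by field_simp; norm_num
    obtain ⟨b, hb, hbν⟩ := hexpand.exists_approx_logPartialSum hV hν hR (by positivity) ha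
      (by positivity) N
    refine ⟨b, hb, ?_⟩
    have h1 : 2 * (4 / μ * ν (x - y) * Real.exp (2 * (4 / μ * (μ / 32))) / (4 / μ) ^ (N + 1)) ≤
        ν (x - y) * μ ^ N := by
      calc _ ≤ 2 * (4 / μ * ν (x - y) * 2 / (4 / μ) ^ (N + 1)) := by gcongr
        _ = 4 * ν (x - y) * μ ^ N * (1 / 4) ^ N := by
          rw [pow_succ, div_pow, one_div_pow]; field_simp; norm_num
        _ ≤ 4 * ν (x - y) * μ ^ N * (1 / 4) ^ 1 := by
          gcongr 4 * ν (x - y) * μ ^ N * ?_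
          exact pow_le_pow_of_le_one (by norm_num) (by norm_num) hN
        _ = _ := by ring
    have h2 : 2 * ν (exp z - 1) * ‖exp z - 1‖ ^ N ≤ 1 / 2 * ν (x - y) * μ ^ N := by
      calc _ ≤ 2 * (2 * ν (x - y)) * (μ / 8) ^ N := by gcongr
        _ = 4 * ν (x - y) * μ ^ N * (1 / 8) ^ N := by rw [div_pow, one_div_pow]; ring
        _ ≤ 4 * ν (x - y) * μ ^ N * (1 / 8) ^ 1 := by
          gcongr 4 * ν (x - y) * μ ^ N * ?_
          exact pow_le_pow_of_le_one (by norm_num) (by norm_num) hN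
        _ = _ := by ring
    have h3 := map_add_le_add ν (z - logPartialSum N (exp z - 1)) (logPartialSum N (exp z - 1) - b)
    rw [sub_add_sub_cancel] at h3
    have h4 := htail N
    linarith

end CStar

/-! ### Bounds for the Hermitian generator -/

section Generator

variable {n : ℕ} {H H' : QMatrix n} {T : ℝ}

theorem norm_I_mul_ofReal (hT : 0 ≤ T) : ‖Complex.I * (T : ℂ)‖ = T := by
  simp [abs_of_nonneg hT]

theorem exp_I_mul_smul_mem_unitary (hH : H.IsHermitian) (T : ℝ) :
    exp ((Complex.I * (T : ℂ)) • H) ∈ unitary (QMatrix n) := by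
  have h : (Complex.I * (T : ℂ)) • H ∈ skewAdjoint (QMatrix n) := by
    rw [skewAdjoint.mem_iff, star_smul, Matrix.star_eq_conjTranspose, hH.eq]
    simp
  let _ : NormedAlgebra ℚ (QMatrix n) := NormedAlgebra.restrictScalars ℚ ℂ (QMatrix n)
  exact exp_mem_unitary_of_mem_skewAdjoint h

theorem existsUnique_isGenerator (hH : H.IsHermitian) (hH' : H'.IsHermitian)
    (hT : 0 ≤ T) (hn : T * ‖H‖ ≤ 1 / 8) (hn' : T * ‖H'‖ ≤ 1 / 8) :
    ∃! W, IsGenerator H H' T W := by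
  have hu : exp ((Complex.I * (T : ℂ)) • H') * exp (-((Complex.I * (T : ℂ)) • H)) ∈
      unitary (QMatrix n) := by
    refine mul_mem (exp_I_mul_smul_mem_unitary hH' T) ?_
    have := exp_I_mul_smul_mem_unitary hH (-T)
    simpa using this
  have hx : ‖(Complex.I * (T : ℂ)) • H'‖ ≤ 1 / 8 := by
    rwa [norm_smul, norm_I_mul_ofReal hT]
  have hy : ‖(Complex.I * (T : ℂ)) • H‖ ≤ 1 / 8 := by
    rwa [norm_smul, norm_I_mul_ofReal hT]
  have h := seminorm_exp_mul_exp_neg_sub_one_le (A := QMatrix n) isIdealSeminorm_normSeminorm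
    le_rfl hx hy
  have h2 := norm_sub_le ((Complex.I * (T : ℂ)) • H') ((Complex.I * (T : ℂ)) • H)
  exact exists_unique_log hu (h.trans (by change 2 * ‖(Complex.I * (T : ℂ)) • H' - (Complex.I * (T : ℂ)) • H‖ ≤ _; linarith))

theorem IsGenerator.bounds {W : QMatrix n} {m : ℕ} {ε C μ : ℝ} (hW : IsGenerator H H' T W)
    (hε : 0 < ε) (hμ0 : 0 < μ) (hμ1 : μ ≤ 1)
    (hT0 : 0 ≤ T) (hT : T * C = μ / 32) (hTμ : T ≤ μ / 32)
    (hm : pauliSparsity H ≤ m) (hm' : pauliSparsity H' ≤ m)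
    (hHC : ‖H‖ ≤ C) (hHC' : ‖H'‖ ≤ C) (hHH : pauliLinftyNorm (H - H') ≤ ε) :
    frobNorm W ≤ Real.sqrt m * ε ∧ opNorm W ≤ m * ε ∧ ∀ N : ℕ, 1 ≤ N →
      ∀ δ : ℝ, μ ^ (N + 1) * Real.sqrt m * ε / 8 ≤ δ →
        pauliQuasiSparsity W δ ≤ (2 * m + 1) ^ N := by
  obtain ⟨hWh, hWπ, hWe⟩ := hW
  obtain ⟨s, hs, h1V, hHV, hHV'⟩ := exists_span_pauliString H H'
  set V := Submodule.span ℂ (pauliString '' (s : Set (Fin n → Fin 4)))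
  set x := (Complex.I * (T : ℂ)) • H' with hx
  set y := (Complex.I * (T : ℂ)) • H with hy
  have hI := norm_I_mul_ofReal hT0
  have hxn : ‖x‖ ≤ μ / 32 := by
    rw [norm_smul, hI, ← hT]; gcongr
  have hyn : ‖y‖ ≤ μ / 32 := by
    rw [norm_smul, hI, ← hT]; gcongr
  have hxy : ∀ ν : Seminorm ℂ (QMatrix n), ν (x - y) = T * ν (H - H') := fun ν => by
    rw [hx, hy, ← smul_sub, map_smul_eq_mul, hI, map_sub_rev]
  have hWsa : IsSelfAdjoint W := hWh
  have hz : IsStarNormal (-(Complex.I • W)) := by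
    have := hWsa.isStarNormal
    have h : Commute (star W) W := this.star_comm_self
    refine ⟨?_⟩
    rw [star_neg, star_smul]
    exact ((h.smul_left _).smul_right _).neg_left.neg_right
  have hνz : ∀ ν : Seminorm ℂ (QMatrix n), ν (-(Complex.I • W)) = ν W := fun ν => by
    rw [map_neg_eq_map, map_smul_eq_mul, Complex.norm_I, one_mul]
  have hzπ : ‖-(Complex.I • W)‖ < Real.pi := by
    rw [norm_neg, norm_smul, Complex.norm_I, one_mul]
    exact hWπ
  have hxV : x ∈ V := V.smul_mem _ hHV'
  have hyV : y ∈ V := V.smul_mem _ hHV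
  have hsp : pauliSparsity (H - H') ≤ 2 * m := (pauliSparsity_sub_le H H').trans (by omega)
  have hspR : (pauliSparsity (H - H') : ℝ) ≤ 2 * m := by exact_mod_cast hsp
  -- The difference has at most `2 * m` Pauli terms, and `√2 ≤ 3 / 2`.
  have hF : frobNorm (H - H') ≤ 3 / 2 * Real.sqrt m * ε := by
    refine (frobNorm_le_sqrt_pauliSparsity_mul _ hε.le hHH).trans ?_
    gcongr
    refine (Real.sqrt_le_sqrt hspR).trans ?_
    rw [Real.sqrt_mul (by norm_num)]
    gcongr
    rw [Real.sqrt_le_left (by norm_num)]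
    norm_num
  have hO : ‖H - H'‖ ≤ 2 * m * ε := by
    refine (opNorm_le_pauliSparsity_mul _ hHH).trans ?_
    gcongr
  obtain ⟨hb1, hb2⟩ := exists_approx_log (isIdealSeminorm_frobSeminorm n) h1V hμ0 hμ1 hxV hyV
    hxn hyn hzπ hWe
  obtain ⟨hb3, -⟩ := exists_approx_log (A := QMatrix n) isIdealSeminorm_normSeminorm h1V hμ0 hμ1
    hxV hyV hxn hyn hzπ hWe
  rw [hνz, hxy, frobSeminorm_apply, frobSeminorm_apply] at hb1
  rw [hνz, hxy] at hb3
  have hsm : 0 ≤ Real.sqrt m * ε := by positivity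
  have hTF : T * frobNorm (H - H') ≤ μ / 32 * (3 / 2 * Real.sqrt m * ε) :=
    mul_le_mul hTμ hF (Real.sqrt_nonneg _) (by positivity)
  refine ⟨?_, ?_, fun N hN δ hδ => ?_⟩
  · have : μ / 32 * (3 / 2 * Real.sqrt m * ε) ≤ 1 / 32 * (3 / 2 * Real.sqrt m * ε) := by gcongr
    linarith
  · have h1 : ‖W‖ ≤ 4 * (T * ‖H - H'‖) := hb3
    have h2 : T * ‖H - H'‖ ≤ 1 / 32 * (2 * m * ε) := by
      gcongr
      linarith
    have h3 : 0 ≤ m * ε := by positivity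
    rw [opNorm_eq_norm]
    linarith
  · obtain ⟨b, hb, hbν⟩ := hb2 N hN
    have e : W - Complex.I • b = Complex.I • (-(Complex.I • W) - b) := by
      rw [smul_sub, smul_neg, smul_smul, Complex.I_mul_I]
      simp
    refine (pauliQuasiSparsity_le hWh (B := Complex.I • b) ?_).trans
      ((pauliSparsity_le_of_mem_span_pow (Submodule.smul_mem _ _ hb)).trans
        (Nat.pow_le_pow_left (by omega) N))
    rw [← frobSeminorm_apply, e, map_smul_eq_mul, Complex.norm_I, one_mul]
    refine hbν.trans (le_trans ?_ hδ)
    rw [hxy, frobSeminorm_apply]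
    calc 3 / 2 * (T * frobNorm (H - H')) * μ ^ N
        ≤ 3 / 2 * (μ / 32 * (3 / 2 * Real.sqrt m * ε)) * μ ^ N := by gcongr
      _ = 9 / 16 * (μ ^ (N + 1) * Real.sqrt m * ε / 8) := by ring
      _ ≤ 1 * (μ ^ (N + 1) * Real.sqrt m * ε / 8) := by gcongr; norm_num
      _ = _ := one_mul _

end Generator

theorem rpow_neg_inv_pow_mul_sqrt_le {m : ℝ} (hm : 1 ≤ m) {K : ℝ} (hK : 0 < K) {ℓ : ℝ} {N : ℕ}
    (hN : ℓ + K / 2 ≤ N + 1) :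
    (m ^ (-1 / K)) ^ (N + 1) * Real.sqrt m ≤ m ^ (-ℓ / K) := by
  have hm0 : 0 < m := by linarith
  rw [← Real.rpow_natCast, ← Real.rpow_mul hm0.le, Real.sqrt_eq_rpow, ← Real.rpow_add hm0]
  refine Real.rpow_le_rpow_of_exponent_le hm ?_
  rw [← sub_nonneg]
  have : -ℓ / K - (-1 / K * ((N + 1 : ℕ) : ℝ) + 1 / 2) = (N + 1 - (ℓ + K / 2)) / K := by
    push_cast; field_simp; ring
  rw [this]
  exact div_nonneg (by linarith) hK.le

end PauliBCH

theorem mainTheorem4 :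
    ∃ c₁ c₂ : ℝ, 0 < c₁ ∧ c₁ ≤ c₂ ∧ ∃ A : ℕ → ℝ → ℝ,
      ∀ K m : ℕ, 1 ≤ K → 1 ≤ m → ∀ C : ℝ, 1 ≤ C →
        ∃ T : ℝ, c₁ * ((m : ℝ) ^ (-1 / (K : ℝ)) / C) ≤ T ∧
          T ≤ c₂ * ((m : ℝ) ^ (-1 / (K : ℝ)) / C) ∧
          ∀ (n : ℕ) (ε : ℝ) (H H' : PauliBCH.QMatrix n), 0 < ε →
            H.IsHermitian → H'.IsHermitian → H.trace = 0 → H'.trace = 0 →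
            PauliBCH.pauliSparsity H ≤ m → PauliBCH.pauliSparsity H' ≤ m →
            PauliBCH.opNorm H ≤ C → PauliBCH.opNorm H' ≤ C →
            PauliBCH.pauliLinftyNorm (H - H') ≤ ε →
            (∃! W : PauliBCH.QMatrix n, PauliBCH.IsGenerator H H' T W) ∧
            ∀ W : PauliBCH.QMatrix n, PauliBCH.IsGenerator H H' T W →
              PauliBCH.frobNorm W ≤ Real.sqrt m * ε ∧
              PauliBCH.opNorm W ≤ m * ε ∧
              ∀ ℓ : ℝ, 1 ≤ ℓ →
                (PauliBCH.pauliQuasiSparsity W ((m : ℝ) ^ (-ℓ / (K : ℝ)) * ε / 8) : ℝ) ≤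
                  A K ℓ * (m : ℝ) ^ (⌈ℓ + (K : ℝ) / 2⌉ - 1) := by
  refine ⟨1 / 32, 1 / 32, by norm_num, le_rfl,
    fun K ℓ => 3 ^ (⌈ℓ + (K : ℝ) / 2⌉ - 1), fun K m hK hm C hC => ?_⟩
  have hmR : (1 : ℝ) ≤ m := by exact_mod_cast hm
  have hKR : (1 : ℝ) ≤ K := by exact_mod_cast hK
  set μ : ℝ := (m : ℝ) ^ (-1 / (K : ℝ)) with hμ
  have hμ0 : 0 < μ := Real.rpow_pos_of_pos (by linarith) _
  have hμ1 : μ ≤ 1 := Real.rpow_le_one_of_one_le_of_nonpos hmR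
    (div_nonpos_of_nonpos_of_nonneg (by norm_num) (by linarith))
  have hC0 : 0 < C := by linarith
  set T : ℝ := 1 / 32 * (μ / C) with hT
  have hT0 : 0 ≤ T := by positivity
  have hTC : T * C = μ / 32 := by rw [hT]; field_simp
  have hTμ : T ≤ μ / 32 := by
    rw [← hTC]; exact le_mul_of_one_le_right hT0 hC
  refine ⟨T, le_rfl, le_rfl, fun n ε H H' hε hH hH' _ _ hm1 hm2 hn hn' hHH => ⟨?_, fun W hW => ?_⟩⟩
  · have h8 : ∀ r : ℝ, r ≤ C → T * r ≤ 1 / 8 := fun r hr =>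
      (mul_le_mul_of_nonneg_left hr hT0).trans (by linarith)
    exact PauliBCH.existsUnique_isGenerator hH hH' hT0 (h8 _ hn) (h8 _ hn')
  · obtain ⟨h1, h2, h3⟩ := hW.bounds hε hμ0 hμ1 hT0 hTC hTμ hm1 hm2 hn hn' hHH
    refine ⟨h1, h2, fun ℓ hℓ => ?_⟩
    -- This makes the truncation degree `N = ⌈ℓ + K / 2⌉ - 1` at least 1, as the approximation
    -- requires.
    have hceil : 1 < ⌈ℓ + (K : ℝ) / 2⌉ := by
      rw [Int.lt_ceil]; push_cast; linarith
    obtain ⟨N, hN⟩ := Int.eq_ofNat_of_zero_le (by omega : 0 ≤ ⌈ℓ + (K : ℝ) / 2⌉ - 1)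
    have hle := Int.le_ceil (ℓ + (K : ℝ) / 2)
    have hN' : ⌈ℓ + (K : ℝ) / 2⌉ = (N : ℤ) + 1 := by omega
    rw [hN'] at hle
    push_cast at hle
    have hδ : μ ^ (N + 1) * Real.sqrt m * ε / 8 ≤ (m : ℝ) ^ (-ℓ / (K : ℝ)) * ε / 8 := by
      gcongr
      exact PauliBCH.rpow_neg_inv_pow_mul_sqrt_le hmR (by linarith) hle
    have h4 := h3 N (by omega) _ hδ
    simp only [hN, zpow_natCast, ← mul_pow]
    -- Since `1 ≤ m`, `2 * m + 1 ≤ 3 * m`; this is the source of `3 ^ N` as the constant `A K ℓ`.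
    calc _ ≤ (((2 * m + 1) ^ N : ℕ) : ℝ) := by exact_mod_cast h4
      _ = (2 * m + 1 : ℝ) ^ N := by push_cast; rfl
      _ ≤ (3 * m) ^ N := by gcongr; linarith
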